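/- Let $\mathcal X,\mathcal S,\mathcal Y$ be finite alphabets, let $Q$ be a PMF on $\mathcal S$ with $Q(s)>0$ for every $s\in\mathcal S$, and let $W(y|x,s)$ be a transition law from $\mathcal X\times\mathcal S$ to $\mathcal Y$ (a state-dependent discrete memoryless channel). All logarithms are to base $2$, and $-\log 0=+\infty$. For a nonempty finite set $\mathcal M$ and a positive integer $n$, an $(n,\mathcal M)$ zero-error feedback code with causal state information consists of encoding maps $f_i\colon \mathcal M\times\mathcal S^{i}\times\mathcal Y^{i-1}\to\mathcal X$, $1\le i\le n$, and pairwise disjoint decoding sets $\mathcal D_m\subseteq\mathcal Y^n$, $m\in\mathcal M$, such that $$\sum_{y^n\in\mathcal Y^n\setminus\mathcal D_m}\ \prod_{i=1}^n W\bigl(y_i\,\big|\,f_i(m,s^i,y^{i-1}),s_i\bigr)=0\qquad\text{for all } m\in\mathcal M,\ s^n\in\mathcal S^n .$$ A rate $R\in\mathbb R$ is achievable if for every sufficiently large $n$ there exists such a code with $\log|\mathcal M|\ge nR$. The causal-state-information zero-error feedback capacity $C^{\mathrm{caus}}_{\mathrm f,0}$ is the supremum of all achievable rates. Let $\mathcal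 U$ be a finite set with $|\mathcal U|=|\mathcal X|^{|\mathcal S|}$ and let $g\colon\mathcal U\times\mathcal S\to\mathcal X$ be such that $\{g(u,\cdot):u\in\mathcal U\}$ is the set $\mathcal X^{\mathcal S}$ of all functions from $\mathcal S$ to $\mathcal X$. Define $$W'(y|u)=\sum_{s\in\mathcal S}Q(s)\,W\bigl(y\,\big|\,g(u,s),s\bigr),\qquad (u,y)\in\mathcal U\times\mathcal Y,$$ and let $\mathscr P(W')$ be the set of transition laws $P_{Y|U}$ from $\mathcal U$ to $\mathcal Y$ such that $P_{Y|U}(y|u)=0$ whenever $W'(y|u)=0$. **Theorem.** If $C^{\mathrm{caus}}_{\mathrm f,0}>0$, then $$C^{\mathrm{caus}}_{\mathrm f,0}=\max_{P_U}\ \min_{P_{Y|U}\in\mathscr P(W')} I(U;Y)=\max_{P_U}\ \min_{y\in\mathcal Y}\ -\log\sum_{u:\,W'(y|u)>0}P_U(u),$$ where $P_U$ ranges over the PMFs on $\mathcal U$, the mutual information is computed with respect to the joint PMF $P_U(u)P_{Y|U}(y|u)$, and all the maxima and minima are attained. Moreover, $W'(y|u)>0$ if and only if $W(y|g(u,s),s)>0$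 for some $s\in\mathcal S$; consequently a transition law $P_{Y|U}$ belongs to $\mathscr P(W')$ if and only if, for all $(u,y)\in\mathcal U\times\mathcal Y$, $P_{Y|U}(y|u)=0$ whenever $W(y|g(u,s),s)=0$ for every $s\in\mathcal S$. -/

import Mathlib

namespace CausalZeroError

open Filter

noncomputable section

/-- A state-dependent discrete memoryless channel: `W x s` is the PMF of the output given the
input `x` and the state `s`, so that `W x s y` is `W(y|x,s)`. -/
abbrev SDChannel (X S Y : Type*) [Fintype Y] := X → S → stdSimplex ℝ Y

/-- An `(n, M)` feedback code with causal state information at the encoder, where times are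
numbered `0, …, n - 1`: at time `i` the encoder sees the message, the states at the times
`0, …, i`, and the outputs at the times `0, …, i - 1`.  The decoding sets are disjoint. -/
structure CausalCode (X S Y : Type*) (n : ℕ) (M : Type*) where
  enc : (i : Fin n) → M → (Fin (i + 1) → S) → (Fin i → Y) → X
  dec : M → Set (Fin n → Y)
  disjoint : ∀ m m', m ≠ m' → Disjoint (dec m) (dec m')

namespace CausalCode

variable {X S Y M : Type*} {n : ℕ}

/-- The input at time `i`, given the message, the state sequence and the output sequence. -/
def input (c : CausalCode X S Y n M) (m : M) (s : Fin n → S) (y : Fin n → Y) (i : Fin n) : X :=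
  c.enc i m (fun j => s (Fin.castLE i.isLt j)) (fun j => y (Fin.castLE i.isLt.le j))

open Classical in
/-- The conditional probability of a decoding error, given the message and the state sequence. -/
def errorProb [Fintype Y] (W : SDChannel X S Y) (c : CausalCode X S Y n M) (m : M)
    (s : Fin n → S) : ℝ :=
  ∑ y : Fin n → Y with y ∉ c.dec m, ∏ i, W (c.input m s y i) (s i) (y i)

/-- The probability of a decoding error is zero for every message and every state sequence. -/
def IsZeroError [Fintype Y] (W : SDChannel X S Y) (c : CausalCode X S Y n M) : Prop :=
  ∀ (m : M) (s : Fin n → S), c.errorProb W m s = 0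

end CausalCode

/-- Rate `R` is achievable: for every sufficiently large blocklength `n` there is a zero-error
code with a (nonempty, finite) message set of size at least `2 ^ (n R)`. -/
def IsAchievable {X S Y : Type*} [Fintype Y] (W : SDChannel X S Y) (R : ℝ) : Prop :=
  ∀ᶠ n : ℕ in atTop, ∃ (M : Type) (_ : Fintype M) (_ : Nonempty M) (c : CausalCode X S Y n M),
    c.IsZeroError W ∧ n * R ≤ Real.logb 2 (Fintype.card M)

/-- The zero-error feedback capacity with causal state information: the supremum, taken in the
extended reals, of all achievable rates. -/
def capacity {X S Y : Type*} [Fintype Y] (W : SDChannel X S Y) : EReal :=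
  sSup ((fun R : ℝ => (R : EReal)) '' {R | IsAchievable W R})

/-- The channel `W'(y|u) = ∑ s, Q(s) W(y|g(u,s),s)` induced by the Shannon strategies `g`. -/
def inducedChannel {X S Y U : Type*} [Fintype S] [Fintype Y] (Q : stdSimplex ℝ S)
    (W : SDChannel X S Y) (g : U → S → X) (u : U) : stdSimplex ℝ Y :=
  ⟨fun y => ∑ s, Q s * W (g u s) s y, by
    refine ⟨fun y => Finset.sum_nonneg fun s _ => mul_nonneg (Q.2.1 s) ((W (g u s) s).2.1 y), ?_⟩
    rw [Finset.sum_comm]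
    have h : ∀ s, ∑ y, Q s * W (g u s) s y = Q s := fun s => by
      rw [← Finset.mul_sum]
      have h1 : ∑ y, W (g u s) s y = 1 := (W (g u s) s).2.2
      rw [h1, mul_one]
    simp only [h]
    exact Q.2.2⟩

/-- The transition laws `V` with `V(·|u) ≪ W(·|u)` for every `u`. -/
def dominatedBy {U Y : Type*} [Fintype Y] (W : U → stdSimplex ℝ Y) : Set (U → stdSimplex ℝ Y) :=
  {V | ∀ u y, W u y = 0 → V u y = 0}

/-- Mutual information, in bits, of a joint PMF `p` on a finite product, with `0 log 0 = 0`. -/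
def mutualInfo {U Y : Type*} [Fintype U] [Fintype Y] (p : U → Y → ℝ) : ℝ :=
  ∑ u, ∑ y, p u y * Real.logb 2 (p u y / ((∑ y', p u y') * ∑ u', p u' y))

/-- `-log₂ t` for `t ≥ 0`, with `-log₂ 0 = +∞`. -/
def negLog (t : ℝ) : EReal := if t = 0 then ⊤ else ((-Real.logb 2 t : ℝ) : EReal)

/-- `v = max_a min_b f a b`, where for every `a` the minimum over `b` is attained, and so is the
maximum over `a` of these minima. -/
def IsMaxMin {A B : Type*} (f : A → B → EReal) (v : EReal) : Prop :=
  (∀ a, ∃ m, IsLeast (Set.range (f a)) m) ∧ IsGreatest {m | ∃ a, IsLeast (Set.range (f a)) m} v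

end

end CausalZeroError

namespace CausalZeroError

open Filter Topology

/-! Only the relation "strategy `u` can produce `y` in some state" matters for zero error. Take the
matrix game whose payoff is 1 when `u` can produce `y` and 0 otherwise, with value `v` and optimal
mixed strategies `P` on `U` and `q` on `Y`. All three quantities equal `-log v`.

Mutual information: the inequality `log x ≤ x - 1` gives at least `-log v` for `P` against every
admissible channel (`le_mutualInfo`). Conditioning `q` on the outputs reachable from `u` gives a
channel with at most `-log v` for every input PMF (`exists_mutualInfo_le`).

Coding: a zero-error code amounts to a game in which feedback shrinks the set of messages still
compatible with the outputs (`ListDecodable`). Averaging over `q`, some output keeps at least a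
fraction `v` of them, whence the converse. Distributing the messages over inputs in proportion to
`P` keeps at most a fraction `v` plus a rounding error, so a bounded list remains. Positive capacity
supplies a code for two messages, which resolves this list bit by bit in a fixed number of uses. -/

/-- The value of a finite matrix game, with optimal mixed strategies of both players. -/
theorem exists_matrixGame_value {U Y : Type*} [Fintype U] [Fintype Y] [Nonempty U] [Nonempty Y]
    (a : U → Y → ℝ) :
    ∃ (P : stdSimplex ℝ U) (q : stdSimplex ℝ Y) (v : ℝ),
      (∀ y, ∑ u, P u * a u y ≤ v) ∧ ∀ u, v ≤ ∑ y, q y * a u y := by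
  classical
  have hc1 : ∀ q : Y → ℝ, IsLinearMap ℝ (fun P : U → ℝ => ∑ u, ∑ y, P u * q y * a u y) := by
    refine fun q => ⟨fun P P' => ?_, fun c P => ?_⟩
    · simp [← Finset.sum_add_distrib, add_mul]
    · simp [Finset.mul_sum, mul_assoc]
  have hc2 : ∀ P : U → ℝ, IsLinearMap ℝ (fun q : Y → ℝ => ∑ u, ∑ y, P u * q y * a u y) := by
    refine fun P => ⟨fun q q' => ?_, fun c q => ?_⟩
    · simp [← Finset.sum_add_distrib, add_mul, mul_add]
    · simp [Finset.mul_sum, mul_assoc, mul_left_comm]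
  -- The payoff is bilinear on compact convex sets; `P` minimizes and `q` maximizes. Comparing the
  -- saddle point with pure strategies gives both bounds.
  obtain ⟨P, hP, q, hq, h⟩ := Sion.exists_isSaddlePointOn
    (X := stdSimplex ℝ U) (Y := stdSimplex ℝ Y)
    (f := fun P q => ∑ u, ∑ y, P u * q y * a u y)
    ⟨_, single_mem_stdSimplex ℝ (Classical.arbitrary U)⟩ (convex_stdSimplex ℝ U)
    (isCompact_stdSimplex ℝ U)
    (fun q _ => (Continuous.lowerSemicontinuous (by fun_prop)).lowerSemicontinuousOn _)
    (fun q _ => (((hc1 q).mk' _).convexOn (convex_stdSimplex ℝ U)).quasiconvexOn)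
    (convex_stdSimplex ℝ Y) ⟨_, single_mem_stdSimplex ℝ (Classical.arbitrary Y)⟩
    (isCompact_stdSimplex ℝ Y)
    (fun P _ => (Continuous.upperSemicontinuous (by fun_prop)).upperSemicontinuousOn _)
    (fun P _ => (((hc2 P).mk' _).concaveOn (convex_stdSimplex ℝ Y)).quasiconcaveOn)
  refine ⟨⟨P, hP⟩, ⟨q, hq⟩, ∑ u, ∑ y, P u * q y * a u y, fun y => ?_, fun u => ?_⟩
  · refine le_trans (le_of_eq ?_) (h P hP _ (single_mem_stdSimplex ℝ y))
    simp only [Pi.single_apply, mul_ite, mul_one, mul_zero, ite_mul, zero_mul,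
      Finset.sum_ite_eq', Finset.mem_univ, if_true]
    rfl
  · refine le_trans (h _ (single_mem_stdSimplex ℝ u) q hq) (le_of_eq ?_)
    simp only [Pi.single_apply, ite_mul, one_mul, zero_mul, Finset.sum_ite_irrel,
      Finset.sum_const_zero, Finset.sum_ite_eq', Finset.mem_univ, if_true]
    rfl

/-! ### Mutual information over channels with a prescribed support -/

section MutualInfo

variable {U Y : Type*} [Fintype U] [Fintype Y]

/-- A combination of values of `x log x` is continuous even where masses vanish, which the quotient
inside the logarithm hides. -/
theorem mutualInfo_eq_entropies {p : U → Y → ℝ} (hp : ∀ u y, 0 ≤ p u y) :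
    mutualInfo p = (∑ u, ∑ y, p u y * Real.log (p u y)
      - ∑ u, (∑ y, p u y) * Real.log (∑ y, p u y)
      - ∑ y, (∑ u, p u y) * Real.log (∑ u, p u y)) / Real.log 2 := by
  have h1 : ∑ y, (∑ u, p u y) * Real.log (∑ u, p u y)
      = ∑ u, ∑ y, p u y * Real.log (∑ u', p u' y) := by
    rw [Finset.sum_comm]
    exact Finset.sum_congr rfl fun y _ => Finset.sum_mul ..
  simp only [mutualInfo]
  rw [h1]
  have h2 : ∀ u, (∑ y, p u y) * Real.log (∑ y, p u y)
      = ∑ y, p u y * Real.log (∑ y', p u y') := fun u => Finset.sum_mul ..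
  simp only [h2, ← Finset.sum_sub_distrib, Finset.sum_div]
  refine Finset.sum_congr rfl fun u _ => Finset.sum_congr rfl fun y _ => ?_
  rcases (hp u y).eq_or_lt with h | h
  · simp [← h]
  · have hu : 0 < ∑ y', p u y' :=
      h.trans_le (Finset.single_le_sum (fun y _ => hp u y) (Finset.mem_univ y))
    have hy : 0 < ∑ u', p u' y :=
      h.trans_le (Finset.single_le_sum (f := fun u => p u y) (fun u _ => hp u y)
        (Finset.mem_univ u))
    rw [Real.logb, Real.log_div h.ne' (mul_pos hu hy).ne', Real.log_mul hu.ne' hy.ne']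
    ring

theorem continuous_mutualInfo (P : stdSimplex ℝ U) :
    Continuous fun V : U → stdSimplex ℝ Y => mutualInfo fun u y => P u * V u y := by
  have h : ∀ V : U → stdSimplex ℝ Y, ∀ u y, 0 ≤ P u * V u y :=
    fun V u y => mul_nonneg (P.2.1 u) ((V u).2.1 y)
  have hc : ∀ u y, Continuous fun V : U → stdSimplex ℝ Y => V u y := fun u y =>
    (continuous_apply y).comp (continuous_subtype_val.comp (continuous_apply u))
  simp only [fun V => mutualInfo_eq_entropies (h V)]
  have hx := Real.continuous_mul_log
  have hc' : ∀ u y, Continuous fun V : U → stdSimplex ℝ Y => P u * V u y :=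
    fun u y => continuous_const.mul (hc u y)
  refine ((Continuous.sub (Continuous.sub ?_ ?_) ?_)).div_const _
  · exact continuous_finsetSum _ fun u _ => continuous_finsetSum _ fun y _ =>
      hx.comp (hc' u y)
  · exact continuous_finsetSum _ fun u _ => hx.comp (continuous_finsetSum _ fun y _ => hc' u y)
  · exact continuous_finsetSum _ fun y _ => hx.comp (continuous_finsetSum _ fun u _ => hc' u y)

theorem mutualInfo_eq (P : stdSimplex ℝ U) (V : U → stdSimplex ℝ Y) :
    mutualInfo (fun u y => P u * V u y) = (∑ u, ∑ y, P u * V u y *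
      Real.log (P u * V u y / (P u * ∑ u', P u' * V u' y))) / Real.log 2 := by
  simp only [mutualInfo, Real.logb, ← Finset.mul_sum, stdSimplex.sum_eq_one, mul_one,
    Finset.sum_div, mul_div_assoc]

theorem sum_joint (P : stdSimplex ℝ U) (V : U → stdSimplex ℝ Y) :
    ∑ u, ∑ y, P u * V u y = 1 := by
  simp [← Finset.mul_sum]

open Classical in
/-- If `P` gives mass at most `v` to the inputs from which `y` can be reached, for every `y`,
then every channel that respects reachability has mutual information at least `-log v`. -/
theorem le_mutualInfo (E : U → Y → Prop) (P : stdSimplex ℝ U) (V : U → stdSimplex ℝ Y) {v : ℝ}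
    (hv : 0 < v) (hP : ∀ y, ∑ u, P u * (if E u y then 1 else 0) ≤ v)
    (hV : ∀ u y, ¬ E u y → V u y = 0) :
    -Real.logb 2 v ≤ mutualInfo fun u y => P u * V u y := by
  rw [mutualInfo_eq, Real.logb, ← neg_div]
  refine div_le_div_of_nonneg_right ?_ (Real.log_nonneg one_le_two)
  set q : Y → ℝ := fun y => ∑ u, P u * V u y with hq
  have hq0 : ∀ y, 0 ≤ q y := fun y =>
    Finset.sum_nonneg fun u _ => mul_nonneg (P.2.1 u) ((V u).2.1 y)
  -- This is `log x ≤ x - 1` at `x = q y / (v * V u y)`. In the sum, the subtracted terms total at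
  -- most 1 because `P` gives mass at most `v` to the inputs reaching `y`.
  have hterm : ∀ u y, P u * V u y * (1 - Real.log v) - q y / v * (P u * if E u y then 1 else 0)
      ≤ P u * V u y * Real.log (P u * V u y / (P u * q y)) := by
    intro u y
    have hPu := P.2.1 u
    rcases (mul_nonneg (P.2.1 u) ((V u).2.1 y)).eq_or_lt with h | h
    · have h' : P u * V u y = 0 := h.symm
      rw [h']
      have : 0 ≤ q y / v * (P u * if E u y then 1 else 0) := by
        have := hq0 y
        have : 0 ≤ P u := hPu
        split_ifs <;> positivity
      linarith
    · have h : 0 < P u * V u y := h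
      have hE : E u y := by
        by_contra hE
        simp [hV u y hE] at h
      have hPu : 0 < P u := lt_of_le_of_ne hPu fun h0 => by
        have : P u = 0 := h0.symm
        simp [this] at h
      have hqy : 0 < q y := h.trans_le
        (Finset.single_le_sum (f := fun u => P u * V u y)
          (fun u _ => mul_nonneg (P.2.1 u) ((V u).2.1 y)) (Finset.mem_univ u))
      have hpq : 0 < P u * q y := mul_pos hPu hqy
      have hlog := Real.log_le_sub_one_of_pos
        (x := P u * q y / (v * (P u * V u y))) (by positivity)
      rw [Real.log_div hpq.ne' (by positivity), Real.log_mul hv.ne' h.ne'] at hlog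
      rw [Real.log_div h.ne' hpq.ne', if_pos hE, mul_one]
      have h2 := mul_le_mul_of_nonneg_left hlog h.le
      have h3 : P u * V u y * (P u * q y / (v * (P u * V u y)) - 1)
          = q y / v * P u - P u * V u y := by
        have hVu : V u y ≠ 0 := (pos_of_mul_pos_right h hPu.le).ne'
        have hPu' : P u ≠ 0 := hPu.ne'
        field_simp
      rw [h3] at h2
      linarith
  have hsum := Finset.sum_le_sum fun u (_ : u ∈ Finset.univ) =>
    Finset.sum_le_sum fun y (_ : y ∈ Finset.univ) => hterm u y
  refine le_trans ?_ hsum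
  simp only [Finset.sum_sub_distrib, ← Finset.sum_mul, sum_joint]
  rw [Finset.sum_comm]
  simp only [← Finset.mul_sum]
  have hq1 : ∑ y, q y = 1 := by
    rw [hq, Finset.sum_comm]
    exact sum_joint P V
  have : ∑ y, q y / v * ∑ u, P u * (if E u y then 1 else 0) ≤ ∑ y, q y := by
    refine Finset.sum_le_sum fun y _ => ?_
    refine (mul_le_mul_of_nonneg_left (hP y) (div_nonneg (hq0 y) hv.le)).trans (le_of_eq ?_)
    field_simp
  linarith

open Classical in
/-- If the PMF `q` gives mass at least `v` to the outputs that can be reached from `u`, for every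
`u`, then conditioning `q` on these outputs is a channel whose mutual information is at most
`-log v` for every input PMF. -/
theorem exists_mutualInfo_le (E : U → Y → Prop) (q : stdSimplex ℝ Y) {v : ℝ} (hv : 0 < v)
    (hq : ∀ u, v ≤ ∑ y, q y * (if E u y then 1 else 0)) :
    ∃ V : U → stdSimplex ℝ Y, (∀ u y, ¬ E u y → V u y = 0) ∧
      ∀ P : stdSimplex ℝ U, mutualInfo (fun u y => P u * V u y) ≤ -Real.logb 2 v := by
  set a : U → ℝ := fun u => ∑ y, q y * (if E u y then 1 else 0) with ha
  have ha0 : ∀ u, 0 < a u := fun u => hv.trans_le (hq u)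
  have hq0 : ∀ y, 0 ≤ q y := fun y => q.2.1 y
  let V : U → stdSimplex ℝ Y := fun u => ⟨fun y => q y * (if E u y then 1 else 0) / a u, by
    refine ⟨fun y => div_nonneg (mul_nonneg (hq0 y) (by split_ifs <;> norm_num)) (ha0 u).le, ?_⟩
    rw [← Finset.sum_div]
    exact div_self (ha0 u).ne'⟩
  have hVa : ∀ u y, V u y = q y * (if E u y then 1 else 0) / a u := fun _ _ => rfl
  refine ⟨V, fun u y h => by simp [hVa, h], fun P => ?_⟩
  rw [mutualInfo_eq, Real.logb, ← neg_div]
  refine div_le_div_of_nonneg_right ?_ (Real.log_nonneg one_le_two)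
  set r : Y → ℝ := fun y => ∑ u, P u * V u y with hr
  have hP0 : ∀ u, 0 ≤ P u := fun u => P.2.1 u
  have hV0 : ∀ u y, 0 ≤ V u y := fun u y => (V u).2.1 y
  -- Since `a u ≥ v`, the ratio `V u y / r y` is at most `q y / r y / v`; then `log x ≤ x - 1` at `x
  -- = q y / r y`, whose average under `r` is at most 1.
  have hterm : ∀ u y, P u * V u y * Real.log (P u * V u y / (P u * r y))
      ≤ P u * V u y * (-Real.log v - 1) + P u * V u y * (q y / r y) := by
    intro u y
    rcases (mul_nonneg (hP0 u) (hV0 u y)).eq_or_lt with h | h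
    · simp [← h]
    · have hPu : 0 < P u := pos_of_mul_pos_left h (hV0 u y)
      have hVu : 0 < V u y := pos_of_mul_pos_right h (hP0 u)
      have hE : E u y := by
        by_contra hE
        simp [hVa, hE] at hVu
      have hry : 0 < r y := h.trans_le
        (Finset.single_le_sum (f := fun u => P u * V u y)
          (fun u _ => mul_nonneg (hP0 u) (hV0 u y)) (Finset.mem_univ u))
      rw [mul_div_mul_left _ _ hPu.ne']
      have hle : V u y / r y ≤ q y / r y / v := by
        rw [hVa, if_pos hE, mul_one, div_right_comm]
        exact div_le_div_of_nonneg_left (div_nonneg (hq0 y) hry.le) hv (hq u)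
      have hqy : 0 < q y / r y / v := (div_pos hVu hry).trans_le hle
      have hqr : 0 < q y / r y := by
        by_contra hn
        exact absurd hqy (not_lt.2 (div_nonpos_of_nonpos_of_nonneg (not_lt.1 hn) hv.le))
      have h1 := Real.log_le_log (div_pos hVu hry) hle
      rw [Real.log_div hqr.ne' hv.ne'] at h1
      have h2 := Real.log_le_sub_one_of_pos hqr
      rw [← mul_add]
      exact mul_le_mul_of_nonneg_left (by linarith) h.le
  refine (Finset.sum_le_sum fun u _ => Finset.sum_le_sum fun y _ => hterm u y).trans ?_
  simp only [Finset.sum_add_distrib, ← Finset.sum_mul, sum_joint]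
  rw [Finset.sum_comm]
  simp only [← Finset.sum_mul]
  have : ∑ y, r y * (q y / r y) ≤ ∑ y, q y := by
    refine Finset.sum_le_sum fun y _ => ?_
    by_cases h : r y = 0
    · simp [h, hq0 y]
    · rw [mul_div_cancel₀ _ h]
  rw [stdSimplex.sum_eq_one] at this
  linarith

end MutualInfo

/-! ### Shrinking the set of compatible messages with feedback -/

section ListDecoding

variable {U Y M N : Type*}

open Classical in
/-- With `n` uses, with feedback, of a channel on which `y` can be received when `u` is sent if
and only if `E u y`, the set of those messages in `A` that are compatible with the outputs can be
brought to satisfy `T`, whatever the outputs are. -/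
def ListDecodable (E : U → Y → Prop) (T : Finset M → Prop) : ℕ → Finset M → Prop
  | 0, A => T A
  | n + 1, A => ∃ φ : M → U, ∀ y, ListDecodable E T n {m ∈ A | E (φ m) y}

variable {E : U → Y → Prop}

theorem ListDecodable.mono {T T' : Finset M → Prop} (h : ∀ A, T A → T' A) {n : ℕ}
    {A : Finset M} (hA : ListDecodable E T n A) : ListDecodable E T' n A := by
  induction n generalizing A with
  | zero => exact h A hA
  | succ n ih =>
    obtain ⟨φ, hφ⟩ := hA
    exact ⟨φ, fun y => ih (hφ y)⟩

/-- Concatenation: the strategy for the last `k` uses may depend on the list left by the first `n`.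
-/
theorem ListDecodable.add {T : Finset M → Prop} {k n : ℕ} {A : Finset M}
    (hA : ListDecodable E (ListDecodable E T k) n A) : ListDecodable E T (k + n) A := by
  induction n generalizing A with
  | zero => exact hA
  | succ n ih =>
    obtain ⟨φ, hφ⟩ := hA
    exact ⟨φ, fun y => ih (hφ y)⟩

open Classical in
-- Each `b` is sent as its label `π b`, so it stays compatible exactly as long as its label does.
theorem ListDecodable.comap {T : Finset M → Prop} {T' : Finset N → Prop} (π : N → M)
    (B : Finset N) (h : ∀ A, T A → T' {b ∈ B | π b ∈ A}) {n : ℕ} {A : Finset M}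
    (hA : ListDecodable E T n A) : ListDecodable E T' n {b ∈ B | π b ∈ A} := by
  induction n generalizing A with
  | zero => exact h A hA
  | succ n ih =>
    obtain ⟨φ, hφ⟩ := hA
    refine ⟨φ ∘ π, fun y => ?_⟩
    convert ih (hφ y) using 1
    ext b
    simp [and_assoc]

/-- If two messages can be distinguished, then so can `2 ^ t`, by sending their bits. -/
theorem ListDecodable.two_pow [Fintype M] [Nontrivial M] {k : ℕ}
    (hM : ListDecodable E (fun A : Finset M => A.card ≤ 1) k Finset.univ) (t : ℕ)
    {B : Finset N} (hB : B.card ≤ 2 ^ t) :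
    ListDecodable E (fun B : Finset N => B.card ≤ 1) (t * k) B := by
  classical
  induction t generalizing B with
  | zero => simpa [ListDecodable] using hB
  | succ t ih =>
    obtain ⟨m₀, m₁, hm⟩ := exists_pair_ne M
    -- Both `B₀` and `B \ B₀` have at most `2 ^ t` elements. One block of `k` uses reveals which of
    -- them contains the message.
    obtain ⟨B₀, hB₀, hcard⟩ := Finset.exists_subset_card_eq (s := B) (n := min B.card (2 ^ t))
      (min_le_left _ _)
    let π : N → M := fun b => if b ∈ B₀ then m₀ else m₁
    have h : ∀ A : Finset M, A.card ≤ 1 →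
        ListDecodable E (fun B : Finset N => B.card ≤ 1) (t * k) {b ∈ B | π b ∈ A} := by
      intro A hA
      apply ih
      by_cases h0 : m₀ ∈ A
      · have h1 : m₁ ∉ A := fun h1 => hm (Finset.card_le_one.1 hA _ h0 _ h1)
        refine (Finset.card_le_card (t := B₀) fun b hb => ?_).trans (by omega)
        by_contra hb0
        simp [π, hb0, h1] at hb
      · refine (Finset.card_le_card (t := B \ B₀) fun b hb => ?_).trans ?_
        · rw [Finset.mem_filter] at hb
          refine Finset.mem_sdiff.2 ⟨hb.1, fun hb0 => ?_⟩
          simp [π, hb0, h0] at hb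
        · rw [Finset.card_sdiff_of_subset hB₀]
          rw [pow_succ] at hB
          omega
    have := (hM.comap π B h).add
    simpa [add_mul] using this

open Classical in
/-- A set of compatible messages cannot shrink faster than by the factor `v` in each step. -/
theorem ListDecodable.card_mul_pow_le [Fintype Y] (q : stdSimplex ℝ Y) {v : ℝ} (hv : 0 ≤ v)
    (hq : ∀ u, v ≤ ∑ y, q y * (if E u y then 1 else 0)) {b : ℝ} {n : ℕ} {A : Finset M}
    (hA : ListDecodable E (fun A : Finset M => (A.card : ℝ) ≤ b) n A) : A.card * v ^ n ≤ b := by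
  induction n generalizing A with
  | zero => simpa [ListDecodable] using hA
  | succ n ih =>
    obtain ⟨φ, hφ⟩ := hA
    have h1 : ∀ y, (({m ∈ A | E (φ m) y} : Finset M).card : ℝ) * v ^ n ≤ b := fun y => ih (hφ y)
    -- Double counting: each message survives with `q`-probability at least `v`.
    have h2 : (A.card : ℝ) * v ≤ ∑ y, q y * ({m ∈ A | E (φ m) y} : Finset M).card := by
      calc (A.card : ℝ) * v = ∑ m ∈ A, v := by simp
        _ ≤ ∑ m ∈ A, ∑ y, q y * (if E (φ m) y then 1 else 0) :=
            Finset.sum_le_sum fun m _ => hq _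
        _ = ∑ y, q y * ({m ∈ A | E (φ m) y} : Finset M).card := by
            rw [Finset.sum_comm]
            simp only [← Finset.mul_sum, Finset.sum_boole]
    calc (A.card : ℝ) * v ^ (n + 1) = A.card * v * v ^ n := by ring
      _ ≤ (∑ y, q y * ({m ∈ A | E (φ m) y} : Finset M).card) * v ^ n :=
          mul_le_mul_of_nonneg_right h2 (pow_nonneg hv n)
      _ = ∑ y, q y * (({m ∈ A | E (φ m) y} : Finset M).card * v ^ n) := by
          rw [Finset.sum_mul]
          exact Finset.sum_congr rfl fun y _ => by ring
      _ ≤ ∑ y, q y * b := Finset.sum_le_sum fun y _ => mul_le_mul_of_nonneg_left (h1 y) (q.2.1 y)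
      _ = b := by rw [← Finset.sum_mul, stdSimplex.sum_eq_one, one_mul]

open Classical in
/-- Messages can be assigned to inputs in proportion to a PMF, up to rounding. -/
theorem exists_fiber_card_le [Fintype U] (P : stdSimplex ℝ U) (A : Finset M) :
    ∃ φ : M → U, ∀ u, (({m ∈ A | φ m = u} : Finset M).card : ℝ) ≤ P u * A.card + 1 := by
  have hU : Nonempty U := by
    by_contra h
    rw [not_nonempty_iff] at h
    simpa using stdSimplex.sum_eq_one P
  -- Input `u` offers `c u` slots. There are at least `A.card` slots in all, so the messages can be
  -- placed injectively.
  let c : U → ℕ := fun u => ⌈P u * A.card⌉₊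
  have hc : Fintype.card A ≤ Fintype.card (Σ u, Fin (c u)) := by
    simp only [Fintype.card_coe, Fintype.card_sigma, Fintype.card_fin]
    have : (A.card : ℝ) ≤ ((∑ u, c u : ℕ) : ℝ) := by
      push_cast
      calc (A.card : ℝ) = ∑ u, P u * A.card := by
            rw [← Finset.sum_mul, stdSimplex.sum_eq_one, one_mul]
        _ ≤ _ := Finset.sum_le_sum fun u _ => Nat.le_ceil _
    exact_mod_cast this
  obtain ⟨e⟩ := Function.Embedding.nonempty_of_card_le hc
  refine ⟨fun m => if h : m ∈ A then (e ⟨m, h⟩).1 else Classical.arbitrary U, fun u => ?_⟩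
  refine le_trans ?_ (Nat.ceil_lt_add_one
    (mul_nonneg (P.2.1 u) (Nat.cast_nonneg A.card))).le
  norm_cast
  have hF : ∀ m : ({m ∈ A | (if h : m ∈ A then (e ⟨m, h⟩).1 else Classical.arbitrary U) = u} :
      Finset M), ∃ i : Fin (c u), ∃ h : m.1 ∈ A, e ⟨m, h⟩ = ⟨u, i⟩ := by
    rintro ⟨m, hm⟩
    obtain ⟨hmA, hmu⟩ := Finset.mem_filter.1 hm
    rw [dif_pos hmA] at hmu
    subst hmu
    exact ⟨_, hmA, rfl⟩
  choose F hF' using hF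
  have := Fintype.card_le_of_injective F fun m m' h => by
    obtain ⟨hm, h1⟩ := hF' m
    obtain ⟨hm', h2⟩ := hF' m'
    rw [h, ← h2] at h1
    exact Subtype.ext (congrArg (Subtype.val (p := (· ∈ A))) (e.injective h1))
  rw [Fintype.card_coe, Fintype.card_fin] at this
  exact this

open Classical in
/-- If `P` gives mass at most `v` to the inputs from which `y` can be reached, for every `y`,
then the set of compatible messages can be made to shrink by the factor `v` in each step, up to
a bounded number of messages. -/
theorem listDecodable_of_card_le [Fintype U] (P : stdSimplex ℝ U) {v : ℝ} (hv : v < 1)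
    (hP : ∀ y, ∑ u, P u * (if E u y then 1 else 0) ≤ v) (n : ℕ) {a : ℝ} {A : Finset M}
    (hA : (A.card : ℝ) ≤ a + Fintype.card U / (1 - v)) (hv0 : 0 ≤ v) :
    ListDecodable E (fun A : Finset M => (A.card : ℝ) ≤ v ^ n * a + Fintype.card U / (1 - v))
      n A := by
  induction n generalizing A a with
  | zero => simpa [ListDecodable] using hA
  | succ n ih =>
    obtain ⟨φ, hφ⟩ := exists_fiber_card_le P A
    refine ⟨φ, fun y => ?_⟩
    rw [pow_succ, mul_assoc]
    apply ih
    have h1 : (({m ∈ A | E (φ m) y} : Finset M).card : ℝ)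
        = ∑ u, (if E u y then 1 else 0) * (({m ∈ A | φ m = u} : Finset M).card : ℝ) := by
      rw [Finset.card_eq_sum_card_fiberwise (f := φ) (t := Finset.univ) (by simp)]
      push_cast
      refine Finset.sum_congr rfl fun u _ => ?_
      rw [Finset.filter_filter]
      split_ifs with h
      · rw [one_mul]
        congr 2
        ext m
        simp only [Finset.mem_filter]
        grind
      · rw [zero_mul, Nat.cast_eq_zero, Finset.card_eq_zero, Finset.filter_eq_empty_iff]
        grind
    have h2 : ∀ u, (if E u y then 1 else 0) * (({m ∈ A | φ m = u} : Finset M).card : ℝ)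
        ≤ P u * (if E u y then 1 else 0) * A.card + 1 := by
      intro u
      have := hφ u
      split_ifs
      · linarith
      · simp
    rw [h1]
    refine (Finset.sum_le_sum fun u _ => h2 u).trans ?_
    rw [Finset.sum_add_distrib, ← Finset.sum_mul]
    have h3 := mul_le_mul_of_nonneg_right (hP y) (Nat.cast_nonneg (α := ℝ) A.card)
    have h4 := mul_le_mul_of_nonneg_left hA hv0
    -- The additive constant is the fixed point of `x ↦ v * x + card U`, where `card U` bounds the
    -- total rounding error of one step.
    have h5 : v * (a + Fintype.card U / (1 - v)) + Fintype.card U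
        = v * a + Fintype.card U / (1 - v) := by
      have : 1 - v ≠ 0 := by linarith
      field_simp
      ring
    simp only [Finset.sum_const, Finset.card_univ, nsmul_eq_mul, mul_one]
    linarith

end ListDecoding

/-! ### Causal encoders versus list-decoding strategies -/

section Codes

variable {X S Y U M : Type*} [Fintype Y]

/-- When the Shannon strategy `u` is used, the output can be `y` for some state. -/
def CanOutput (W : SDChannel X S Y) (g : U → S → X) (u : U) (y : Y) : Prop :=
  ∃ s, 0 < W (g u s) s y

open Classical in
-- The first input is a function of the first state, hence a Shannon strategy. Once `y₀` is seen,
-- the past state is replaced by one fixed `s₀ m` that allows `y₀`. This only restricts the state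
-- sequences, so no compatible messages are gained.
theorem listDecodable_of_compatible [Nonempty S] (W : SDChannel X S Y) {g : U → S → X}
    (hg : Set.range g = Set.univ) (n : ℕ) (A : Finset M)
    (enc : (i : Fin n) → M → (Fin (i + 1) → S) → (Fin i → Y) → X)
    (h : ∀ y : Fin n → Y, ({m ∈ A | ∃ s : Fin n → S, ∀ i,
      0 < W (enc i m (fun j => s (Fin.castLE i.isLt j)) (fun j => y (Fin.castLE i.isLt.le j)))
        (s i) (y i)} : Finset M).card ≤ 1) :
    ListDecodable (CanOutput W g) (fun A : Finset M => A.card ≤ 1) n A := by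
  induction n generalizing A with
  | zero => simpa [ListDecodable] using h Fin.elim0
  | succ n ih =>
    have hφ : ∀ m, ∃ u, g u = fun s => enc 0 m (fun _ => s) Fin.elim0 := fun m => by
      have : (fun s => enc 0 m (fun _ => s) Fin.elim0) ∈ Set.range g := hg ▸ Set.mem_univ _
      exact this
    choose φ hφ using hφ
    refine ⟨φ, fun y₀ => ?_⟩
    have hs : ∀ m, ∃ s₀, (∃ s, 0 < W (g (φ m) s) s y₀) → 0 < W (g (φ m) s₀) s₀ y₀ := by
      intro m
      by_cases hm : ∃ s, 0 < W (g (φ m) s) s y₀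
      · exact ⟨hm.choose, fun _ => hm.choose_spec⟩
      · exact ⟨Classical.arbitrary S, fun hm' => absurd hm' hm⟩
    choose s₀ hs₀ using hs
    refine ih _ (fun i m s y => enc i.succ m (Fin.cons (s₀ m) s) (Fin.cons y₀ y)) fun y => ?_
    refine (Finset.card_le_card fun m hm => ?_).trans (h (Fin.cons y₀ y))
    simp only [Finset.mem_filter] at hm ⊢
    obtain ⟨⟨hmA, hm0⟩, s, hs⟩ := hm
    refine ⟨hmA, Fin.cons (s₀ m) s, fun i => ?_⟩
    induction i using Fin.cases with
    | zero =>
      have := hs₀ m hm0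
      rw [hφ] at this
      convert this using 4
      · change enc 0 m _ _ = enc 0 m _ _
        congr 1
        · funext j
          obtain rfl : j = (0 : Fin 1) := Subsingleton.elim (α := Fin 1) _ _
          rfl
        · funext j
          exact Fin.elim0 j
      · rfl
      · rfl
    | succ i =>
      convert hs i using 4
      all_goals first
        | rfl
        | (funext j; induction j using Fin.cases <;> rfl)

open Classical in
-- Strategies are applied to the current state. Compatibility with some state sequence then splits
-- into separate conditions for each time, as the states can be chosen independently.
theorem exists_compatible_of_listDecodable [Nonempty X] (W : SDChannel X S Y) (g : U → S → X)
    {T : Finset M → Prop} {n : ℕ} {A : Finset M}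
    (h : ListDecodable (CanOutput W g) T n A) :
    ∃ enc : (i : Fin n) → M → (Fin (i + 1) → S) → (Fin i → Y) → X, ∀ y : Fin n → Y,
      T {m ∈ A | ∃ s : Fin n → S, ∀ i,
        0 < W (enc i m (fun j => s (Fin.castLE i.isLt j)) (fun j => y (Fin.castLE i.isLt.le j)))
          (s i) (y i)} := by
  induction n generalizing A with
  | zero => exact ⟨fun i => i.elim0, fun y => by simpa [ListDecodable] using h⟩
  | succ n ih =>
    obtain ⟨φ, hφ⟩ := h
    choose enc henc using fun y => ih (hφ y)
    refine ⟨fun i => Fin.cases (motive := fun i : Fin (n + 1) =>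
        M → (Fin (i + 1) → S) → (Fin i → Y) → X) (fun m s _ => g (φ m) (s 0))
      (fun i m s y => enc (y (0 : Fin (i + 1))) i m (Fin.tail s) (fun j => y j.succ)) i, fun y => ?_⟩
    convert henc (y 0) (Fin.tail y) using 1
    ext m
    simp only [Finset.mem_filter, and_assoc]
    refine and_congr_right fun _ => ⟨?_, ?_⟩
    · rintro ⟨s, hs⟩
      exact ⟨⟨s 0, hs 0⟩, Fin.tail s, fun i => hs i.succ⟩
    · rintro ⟨⟨s₀, h0⟩, s, hs⟩
      refine ⟨Fin.cons s₀ s, fun i => ?_⟩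
      induction i using Fin.cases with
      | zero => exact h0
      | succ i => exact hs i

end Codes

/-! ### The capacity as the logarithm of the game value -/

section Capacity

variable {X S Y U M : Type*} [Fintype Y]

theorem inducedChannel_pos_iff [Fintype S] (Q : stdSimplex ℝ S) (hQ : ∀ s, 0 < Q s)
    (W : SDChannel X S Y) (g : U → S → X) (u : U) (y : Y) :
    0 < inducedChannel Q W g u y ↔ CanOutput W g u y := by
  have h0 : ∀ s ∈ Finset.univ, 0 ≤ Q s * W (g u s) s y := fun s _ =>
    mul_nonneg (hQ s).le ((W (g u s) s).2.1 y)
  change 0 < ∑ s, Q s * W (g u s) s y ↔ ∃ s, 0 < W (g u s) s y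
  rw [Finset.sum_pos_iff_of_nonneg h0]
  simp [hQ]

theorem CausalCode.IsZeroError.listDecodable [Nonempty S] [Fintype M] {W : SDChannel X S Y}
    {g : U → S → X} (hg : Set.range g = Set.univ) {n : ℕ} {c : CausalCode X S Y n M}
    (hc : c.IsZeroError W) :
    ListDecodable (CanOutput W g) (fun A : Finset M => A.card ≤ 1) n
      Finset.univ := by
  classical
  refine listDecodable_of_compatible W hg n _ c.enc fun y => ?_
  have key : ∀ m, (∃ s : Fin n → S, ∀ i, 0 < W (c.input m s y i) (s i) (y i)) → y ∈ c.dec m := by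
    rintro m ⟨s, hs⟩
    by_contra hy
    have h := hc m s
    rw [CausalCode.errorProb, Finset.sum_eq_zero_iff_of_nonneg fun y _ =>
      Finset.prod_nonneg fun i _ => stdSimplex.zero_le (W (c.input m s y i) (s i)) (y i)] at h
    -- A vanishing sum of nonnegative terms has no positive term, so every output sequence of
    -- positive probability is decoded to `m`.
    exact (Finset.prod_pos fun i _ => hs i).ne' (h y (by simpa using hy))
  refine Finset.card_le_one.2 fun m hm m' hm' => ?_
  by_contra hne
  exact Set.disjoint_left.1 (c.disjoint m m' hne) (key m (Finset.mem_filter.1 hm).2)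
    (key m' (Finset.mem_filter.1 hm').2)

theorem exists_isZeroError [Nonempty X] [Fintype M] (W : SDChannel X S Y) (g : U → S → X) {n : ℕ}
    (h : ListDecodable (CanOutput W g) (fun A : Finset M => A.card ≤ 1) n
      Finset.univ) : ∃ c : CausalCode X S Y n M, c.IsZeroError W := by
  classical
  obtain ⟨enc, henc⟩ := exists_compatible_of_listDecodable W g h
  -- The decoding set of `m` consists of the outputs compatible with `m`; lists of size at most one
  -- make these sets disjoint.
  refine ⟨⟨enc, fun m => {y | ∃ s : Fin n → S, ∀ i, 0 < W (enc i m
      (fun j => s (Fin.castLE i.isLt j)) (fun j => y (Fin.castLE i.isLt.le j))) (s i) (y i)},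
    fun m m' hne => Set.disjoint_left.2 fun y hy hy' => hne ?_⟩, fun m s => ?_⟩
  · exact Finset.card_le_one.1 (henc y) m (Finset.mem_filter.2 ⟨Finset.mem_univ _, hy⟩) m'
      (Finset.mem_filter.2 ⟨Finset.mem_univ _, hy'⟩)
  · refine Finset.sum_eq_zero fun y hy => ?_
    have hy := (Finset.mem_filter.1 hy).2
    by_contra hne
    refine hy ⟨s, fun i => lt_of_le_of_ne ((W _ _).2.1 _) fun h0 => hne ?_⟩
    exact Finset.prod_eq_zero (Finset.mem_univ i) h0.symm

open Classical in
theorem CausalCode.IsZeroError.card_mul_pow_le [Nonempty S] [Fintype M] {W : SDChannel X S Y}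
    {g : U → S → X} (hg : Set.range g = Set.univ) (q : stdSimplex ℝ Y) {v : ℝ} (hv : 0 ≤ v)
    (hq : ∀ u, v ≤ ∑ y, q y * (if CanOutput W g u y then 1 else 0))
    {n : ℕ} {c : CausalCode X S Y n M} (hc : c.IsZeroError W) :
    Fintype.card M * v ^ n ≤ 1 :=
  ((hc.listDecodable hg).mono fun A hA => by exact_mod_cast hA).card_mul_pow_le q hv hq

open Classical in
theorem IsAchievable.le_neg_logb [Nonempty S] {W : SDChannel X S Y}
    {g : U → S → X} (hg : Set.range g = Set.univ) (q : stdSimplex ℝ Y) {v : ℝ} (hv : 0 < v)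
    (hq : ∀ u, v ≤ ∑ y, q y * (if CanOutput W g u y then 1 else 0)) {R : ℝ}
    (hR : IsAchievable W R) : R ≤ -Real.logb 2 v := by
  obtain ⟨n, ⟨M, _, _, c, hc, hn⟩, hn0⟩ := (hR.and (eventually_gt_atTop 0)).exists
  have h := hc.card_mul_pow_le hg q hv.le hq
  have hM : (0 : ℝ) < Fintype.card M := by exact_mod_cast Fintype.card_pos
  have h1 := Real.logb_le_logb_of_le one_lt_two (by positivity) h
  rw [Real.logb_one, Real.logb_mul hM.ne' (by positivity), Real.logb_pow] at h1
  have hn0' : (0 : ℝ) < n := by exact_mod_cast hn0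
  by_contra hlt
  nlinarith

/-- A code for at least two messages can be extracted from a positive capacity. -/
theorem exists_code_of_capacity_pos {W : SDChannel X S Y} (h : 0 < capacity W) :
    ∃ n : ℕ, 0 < n ∧ ∃ (M : Type) (_ : Fintype M) (_ : Nontrivial M) (c : CausalCode X S Y n M),
      c.IsZeroError W := by
  obtain ⟨_, ⟨R, hR, rfl⟩, hpos⟩ := lt_sSup_iff.1 h
  obtain ⟨n, ⟨M, _, _, c, hc, hn⟩, hn0⟩ := (hR.and (eventually_gt_atTop 0)).exists
  refine ⟨n, hn0, M, ‹_›, ?_, c, hc⟩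
  have hR0 : 0 < R := EReal.coe_lt_coe_iff.1 hpos
  have hn0' : (0 : ℝ) < n := by exact_mod_cast hn0
  by_contra hM
  rw [not_nontrivial_iff_subsingleton] at hM
  have : Fintype.card M ≤ 1 := Fintype.card_le_one_iff_subsingleton.2 hM
  have h1 : Fintype.card M = 1 := le_antisymm this Fintype.card_pos
  rw [h1] at hn
  simp only [Nat.cast_one, Real.logb_one] at hn
  nlinarith

open Classical in
theorem isAchievable_of_lt_neg_logb [Fintype U] [Nonempty X] [Nonempty S] {W : SDChannel X S Y}
    {g : U → S → X} (hg : Set.range g = Set.univ) (P : stdSimplex ℝ U) {v : ℝ} (hv0 : 0 < v)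
    (hv1 : v < 1)
    (hP : ∀ y, ∑ u, P u * (if CanOutput W g u y then 1 else 0) ≤ v)
    {M : Type*} [Fintype M] [Nontrivial M] {k : ℕ} {c : CausalCode X S Y k M}
    (hc : c.IsZeroError W) {R : ℝ} (hR : R < -Real.logb 2 v) : IsAchievable W R := by
  -- With `⌊v⁻¹ ^ l⌋` messages, at most `1 + card U / (1 - v)` remain after `l` uses, so `t` bits in
  -- `t * k` further uses finish. The number `t` does not depend on `l`.
  obtain ⟨t, ht⟩ := pow_unbounded_of_one_lt (1 + Fintype.card U / (1 - v)) one_lt_two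
  have hlim : Tendsto (fun n : ℕ => n * (-Real.logb 2 v - R)) atTop atTop :=
    tendsto_natCast_atTop_atTop.atTop_mul_const (sub_pos.2 hR)
  filter_upwards [eventually_ge_atTop (t * k),
    -- The first term pays for the `t * k` extra uses, the `1` for the floor, which loses at most a
    -- factor 2.
    hlim.eventually_ge_atTop (((t * k : ℕ) : ℝ) * -Real.logb 2 v + 1)] with n hn hn'
  obtain ⟨l, rfl⟩ := Nat.exists_eq_add_of_le hn
  have hvl : 1 ≤ v⁻¹ ^ l := one_le_pow₀ ((one_le_inv₀ hv0).2 hv1.le)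
  set N := ⌊v⁻¹ ^ l⌋₊ with hN
  have hN1 : 1 ≤ N := Nat.le_floor (by exact_mod_cast hvl)
  have hc0 : 0 ≤ Fintype.card U / (1 - v) := div_nonneg (Nat.cast_nonneg _) (by linarith)
  have hlist := listDecodable_of_card_le (E := CanOutput W g) P hv1 hP l
    (a := v⁻¹ ^ l) (A := (Finset.univ : Finset (Fin N))) (by
      have : (N : ℝ) ≤ v⁻¹ ^ l := Nat.floor_le (by positivity)
      simpa using this.trans (le_add_of_nonneg_right hc0)) hv0.le
  have hdec := (hlist.mono fun A hA => (hc.listDecodable hg).two_pow t (B := A) (by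
    rw [← mul_pow, mul_inv_cancel₀ hv0.ne', one_pow] at hA
    exact_mod_cast hA.trans ht.le)).add
  obtain ⟨c', hc'⟩ := exists_isZeroError W g hdec
  refine ⟨Fin N, inferInstance, ⟨⟨0, hN1⟩⟩, c', hc', ?_⟩
  have h2 : v⁻¹ ^ l / 2 ≤ N := by
    have h3 := Nat.lt_floor_add_one (v⁻¹ ^ l)
    have h4 : (1 : ℝ) ≤ N := by exact_mod_cast hN1
    rw [← hN] at h3
    linarith
  have h5 := Real.logb_le_logb_of_le one_lt_two (by positivity) h2
  rw [Real.logb_div (by positivity) two_ne_zero, Real.logb_pow, Real.logb_inv,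
    Real.logb_self_eq_one one_lt_two] at h5
  rw [Fintype.card_fin]
  push_cast at hn' ⊢
  linarith

open Classical in
theorem capacity_eq_neg_logb [Fintype U] [Nonempty S] {W : SDChannel X S Y} {g : U → S → X}
    (hg : Set.range g = Set.univ) (h : 0 < capacity W) (P : stdSimplex ℝ U) (q : stdSimplex ℝ Y)
    {v : ℝ} (hv : 0 < v)
    (hP : ∀ y, ∑ u, P u * (if CanOutput W g u y then 1 else 0) ≤ v)
    (hq : ∀ u, v ≤ ∑ y, q y * (if CanOutput W g u y then 1 else 0)) :
    capacity W = ((-Real.logb 2 v : ℝ) : EReal) := by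
  obtain ⟨k, hk, M, _, _, c, hc⟩ := exists_code_of_capacity_pos h
  have hX : Nonempty X :=
    ⟨c.enc ⟨0, hk⟩ (Classical.arbitrary M) (fun _ => Classical.arbitrary S) Fin.elim0⟩
  -- With `v ≥ 1` no message could ever be excluded, contradicting the code for at least two
  -- messages.
  have hv1 : v < 1 := by
    by_contra hv1
    have h1 := hc.card_mul_pow_le hg q hv.le hq
    have h2 : (1 : ℝ) < Fintype.card M := by exact_mod_cast Fintype.one_lt_card
    have h3 : 1 ≤ v ^ k := one_le_pow₀ (not_lt.1 hv1)
    nlinarith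
  apply le_antisymm
  · refine sSup_le ?_
    rintro _ ⟨R, hR, rfl⟩
    exact EReal.coe_le_coe_iff.2 (IsAchievable.le_neg_logb hg q hv hq hR)
  · by_contra hlt
    obtain ⟨R, hR1, hR2⟩ := EReal.lt_iff_exists_real_btwn.1 (not_le.1 hlt)
    refine hR1.not_ge (le_sSup ⟨R, ?_, rfl⟩)
    exact isAchievable_of_lt_neg_logb hg P hv hv1 hP hc (EReal.coe_lt_coe_iff.1 hR2)

end Capacity

/-! ### Max-min values and attainment -/

theorem negLog_of_pos {t : ℝ} (ht : 0 < t) : negLog t = ((-Real.logb 2 t : ℝ) : EReal) :=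
  if_neg ht.ne'

theorem negLog_le_negLog {s t : ℝ} (hs : 0 ≤ s) (hst : s ≤ t) : negLog t ≤ negLog s := by
  rcases hs.eq_or_lt with rfl | hs
  · simp [negLog]
  · rw [negLog_of_pos hs, negLog_of_pos (hs.trans_le hst), EReal.coe_le_coe_iff, neg_le_neg_iff]
    exact Real.logb_le_logb_of_le one_lt_two hs hst

/-- A max-min is established by optimal strategies of both players. -/
theorem IsMaxMin.of_saddle {A B : Type*} {f : A → B → EReal} {v : EReal}
    (hmin : ∀ a, ∃ m, IsLeast (Set.range (f a)) m) (a₀ : A) (ha : ∀ b, v ≤ f a₀ b)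
    (hb : ∀ a, ∃ b, f a b ≤ v) : IsMaxMin f v := by
  have hle : ∀ a m, IsLeast (Set.range (f a)) m → m ≤ v := fun a m hm => by
    obtain ⟨b, hb⟩ := hb a
    exact (hm.2 ⟨b, rfl⟩).trans hb
  refine ⟨hmin, ⟨a₀, ?_⟩, fun m ⟨a, hm⟩ => hle a m hm⟩
  obtain ⟨m, hm⟩ := hmin a₀
  have : v ≤ m := by
    obtain ⟨b, rfl⟩ := hm.1
    exact ha b
  exact le_antisymm this (hle a₀ m hm) ▸ hm

theorem isCompact_dominatedBy {U Y : Type*} [Fintype Y] (W : U → stdSimplex ℝ Y) :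
    IsCompact (dominatedBy W) := by
  refine IsClosed.isCompact ?_
  simp only [dominatedBy, Set.ofPred_forall]
  refine isClosed_iInter fun u => isClosed_iInter fun y => isClosed_iInter fun _ => ?_
  exact isClosed_eq ((continuous_apply y).comp
    (continuous_subtype_val.comp (continuous_apply u))) continuous_const

theorem exists_isLeast_mutualInfo {U Y : Type*} [Fintype U] [Fintype Y] (W : U → stdSimplex ℝ Y)
    (P : stdSimplex ℝ U) :
    ∃ m, IsLeast (Set.range fun V : dominatedBy W =>
      ((mutualInfo fun u y => P u * V.1 u y : ℝ) : EReal)) m := by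
  have : CompactSpace (dominatedBy W) := isCompact_iff_compactSpace.1 (isCompact_dominatedBy W)
  have : Nonempty (dominatedBy W) := ⟨⟨W, fun _ _ h => h⟩⟩
  exact (isCompact_range (continuous_coe_real_ereal.comp
    ((continuous_mutualInfo P).comp continuous_subtype_val))).exists_isLeast (Set.range_nonempty _)

end CausalZeroError

/-! ### The main theorem -/

theorem mainTheorem6 {X S Y U : Type*} [Fintype X] [Fintype S] [Fintype Y] [Fintype U]
    (Q : stdSimplex ℝ S) (hQ : ∀ s, 0 < Q s)
    (W : CausalZeroError.SDChannel X S Y)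
    (g : U → S → X) (hU : Fintype.card U = Fintype.card X ^ Fintype.card S)
    (hg : Set.range g = Set.univ) :
    (0 < CausalZeroError.capacity W →
      CausalZeroError.IsMaxMin
        (fun (P : stdSimplex ℝ U)
            (V : CausalZeroError.dominatedBy (CausalZeroError.inducedChannel Q W g)) =>
          ((CausalZeroError.mutualInfo fun u y => P u * V.1 u y : ℝ) : EReal))
        (CausalZeroError.capacity W) ∧
      CausalZeroError.IsMaxMin
        (fun (P : stdSimplex ℝ U) (y : Y) =>
          CausalZeroError.negLog
            (∑ u : U with 0 < CausalZeroError.inducedChannel Q W g u y, P u))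
        (CausalZeroError.capacity W)) ∧
    (∀ u y, 0 < CausalZeroError.inducedChannel Q W g u y ↔ ∃ s, 0 < W (g u s) s y) ∧
    (∀ V : U → stdSimplex ℝ Y,
      V ∈ CausalZeroError.dominatedBy (CausalZeroError.inducedChannel Q W g) ↔
        ∀ u y, (∀ s, W (g u s) s y = 0) → V u y = 0) := by
  classical
  have hE := CausalZeroError.inducedChannel_pos_iff Q hQ W g
  have hE0 : ∀ u y, CausalZeroError.inducedChannel Q W g u y = 0 ↔
      ¬ CausalZeroError.CanOutput W g u y := fun u y => by
    rw [← hE, not_lt]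
    exact ⟨le_of_eq, fun h => le_antisymm h ((CausalZeroError.inducedChannel Q W g u).2.1 y)⟩
  refine ⟨fun hpos => ?_, hE, fun V => forall_congr' fun u => forall_congr' fun y => ?_⟩
  · have hS : Nonempty S := by
      by_contra h
      rw [not_nonempty_iff] at h
      simpa using stdSimplex.sum_eq_one Q
    obtain ⟨k, hk, M, _, _, c, -⟩ := CausalZeroError.exists_code_of_capacity_pos hpos
    have x₀ : X :=
      c.enc ⟨0, hk⟩ (Classical.arbitrary M) (fun _ => Classical.arbitrary S) Fin.elim0
    have hUne : Nonempty U := by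
      obtain ⟨u, -⟩ : (fun _ => x₀) ∈ Set.range g := hg ▸ Set.mem_univ _
      exact ⟨u⟩
    have hpos' : ∀ V : stdSimplex ℝ Y, ∃ y, 0 < V y := fun V => by
      by_contra! h
      have := Finset.sum_nonpos fun y (_ : y ∈ Finset.univ) => h y
      rw [stdSimplex.sum_eq_one] at this
      linarith
    have hYne : Nonempty Y := ⟨(hpos' (W x₀ (Classical.arbitrary S))).choose⟩
    obtain ⟨P, q, v, hP, hq⟩ := CausalZeroError.exists_matrixGame_value
      fun (u : U) (y : Y) => if CausalZeroError.CanOutput W g u y then (1 : ℝ) else 0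
    -- An input of positive mass under `P` reaches some output, and that output already has positive
    -- payoff.
    have hv : 0 < v := by
      obtain ⟨u, hu⟩ : ∃ u, 0 < P u := by
        by_contra! h
        have := Finset.sum_nonpos fun u (_ : u ∈ Finset.univ) => h u
        rw [stdSimplex.sum_eq_one] at this
        linarith
      obtain ⟨y, hy⟩ := hpos' (CausalZeroError.inducedChannel Q W g u)
      refine lt_of_lt_of_le ?_ (hP y)
      refine lt_of_lt_of_le ?_ (Finset.single_le_sum (fun u _ => mul_nonneg (P.2.1 u) ?_)
        (Finset.mem_univ u))
      · rw [if_pos ((hE u y).1 hy), mul_one]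
        exact hu
      · split_ifs <;> norm_num
    have hsum : ∀ (P : stdSimplex ℝ U) (y : Y),
        ∑ u : U with 0 < CausalZeroError.inducedChannel Q W g u y, P u
          = ∑ u, P u * (if CausalZeroError.CanOutput W g u y then 1 else 0) := fun P y => by
      simp [Finset.sum_filter, hE]
    have hsum0 : ∀ (P : stdSimplex ℝ U) (y : Y),
        0 ≤ ∑ u : U with 0 < CausalZeroError.inducedChannel Q W g u y, P u := fun P y =>
      Finset.sum_nonneg fun u _ => P.2.1 u
    rw [CausalZeroError.capacity_eq_neg_logb hg hpos P q hv hP hq]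
    constructor
    · obtain ⟨V, hV, hVle⟩ := CausalZeroError.exists_mutualInfo_le
        (CausalZeroError.CanOutput W g) q hv hq
      refine .of_saddle (CausalZeroError.exists_isLeast_mutualInfo _) P (fun V' => ?_)
        fun P' => ⟨⟨V, fun u y h => hV u y ((hE0 u y).1 h)⟩, EReal.coe_le_coe_iff.2 (hVle P')⟩
      exact EReal.coe_le_coe_iff.2 (CausalZeroError.le_mutualInfo _ P V'.1 hv hP
        fun u y h => V'.2 u y ((hE0 u y).2 h))
    · rw [← CausalZeroError.negLog_of_pos hv]
      refine .of_saddle (fun P' => ?_) P (fun y => ?_) fun P' => ?_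
      · exact (Set.finite_range _).isCompact.exists_isLeast (Set.range_nonempty _)
      · exact CausalZeroError.negLog_le_negLog (hsum0 P y) ((hsum P y).trans_le (hP y))
      · obtain ⟨y, hy⟩ : ∃ y, v ≤ ∑ u, P' u * (if CausalZeroError.CanOutput W g u y then 1 else 0) := by
          by_contra! hlt
          have h1 : v ≤ ∑ u, P' u * ∑ y, q y * (if CausalZeroError.CanOutput W g u y then 1 else 0) :=
            calc v = ∑ u, P' u * v := by
                  rw [← Finset.sum_mul, stdSimplex.sum_eq_one, one_mul]
              _ ≤ _ := Finset.sum_le_sum fun u _ =>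
                  mul_le_mul_of_nonneg_left (hq u) (P'.2.1 u)
          have h2 : ∑ u, P' u * ∑ y, q y * (if CausalZeroError.CanOutput W g u y then (1 : ℝ) else 0)
              = ∑ y, q y * ∑ u, P' u * (if CausalZeroError.CanOutput W g u y then 1 else 0) := by
            simp only [Finset.mul_sum]
            rw [Finset.sum_comm]
            exact Finset.sum_congr rfl fun _ _ => Finset.sum_congr rfl fun _ _ => by ring
          obtain ⟨y, hy⟩ := hpos' q
          have h3 : ∑ y, q y * ∑ u, P' u * (if CausalZeroError.CanOutput W g u y then (1 : ℝ) else 0)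
              < ∑ y, q y * v :=
            Finset.sum_lt_sum (fun y _ => mul_le_mul_of_nonneg_left (hlt y).le (q.2.1 y))
              ⟨y, Finset.mem_univ y, mul_lt_mul_of_pos_left (hlt y) hy⟩
          rw [← Finset.sum_mul, stdSimplex.sum_eq_one, one_mul] at h3
          linarith
        exact ⟨y, CausalZeroError.negLog_le_negLog hv.le (hy.trans_eq (hsum P' y).symm)⟩
  · rw [hE0, CausalZeroError.CanOutput]
    refine imp_congr_left ?_
    push Not
    exact forall_congr' fun s => ⟨fun h => le_antisymm h ((W (g u s) s).2.1 y), le_of_eq⟩
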